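/- A polynomial $r(z,\bar w)=\sum_{a,b} c_{ab}\,z^a\bar w^b$ ($z,w\in\mathbb C$, $c_{ab}\in\mathbb C$, finite sum) is called Hermitian symmetric if $r(z,\bar w)=\overline{r(w,\bar z)}$ for all $z,w\in\mathbb C$; then $r(z,\bar z)$ is real for all $z$. A squared norm is a Hermitian symmetric polynomial of the form $\|F(z)\|^2=\sum_{j=1}^N|F_j(z)|^2$, where $F=(F_1,\dots,F_N)$ is a holomorphic polynomial mapping (each $F_j\in\mathbb C[z]$, $N\ge 0$). Let $\mathcal Q$ be the set of Hermitian symmetric polynomials that are quotients of squared norms, i.e. $r(z,\bar z)=\|F(z)\|^2/\|G(z)\|^2$ wherever $G(z)\neq 0$, for some holomorphic polynomial mappings $F,G$ with $G\not\equiv 0$. Let $r(z,\bar z)$ be a Hermitian symmetric polynomial in one variable. Then $r\in\mathcal Q$ if and only if one of the following holds: either $r$ vanishes identically, or the zero set $\{z\in\mathbb C: r(z,\bar z)=0\}$ is a finite (possibly empty) set $\{p_1,\dots,p_K\}$ (repetitions allowed in the list) such that $$ r(z,\bar z)=\prod_{j=1}^K|z-p_j|^2\; s(z,\bar z), $$ where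 $s$ is a Hermitian symmetric polynomial satisfying both of the following conditions: 1) $s$ is strictly positive, i.e. $s(z,\bar z)>0$ for all $z\in\mathbb C$; 2) the total degree of $s$ (as a polynomial in $z$ and $\bar z$) is twice the degree of $s$ in $z$. -/

import Mathlib

open ComplexConjugate

namespace HermPoly

/-- A polynomial `r(z, w̄)` in one complex variable and one conjugate variable:
`X 0` stands for `z`, and `X 1` for the conjugated variable. -/
abbrev BiPoly : Type := MvPolynomial (Fin 2) ℂ

/-- The polarized value `r(z, w̄)`. -/
noncomputable def pol (r : BiPoly) (z w : ℂ) : ℂ :=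
  MvPolynomial.eval ![z, conj w] r

/-- The value `r(z, z̄)`. -/
noncomputable def val (r : BiPoly) (z : ℂ) : ℂ := pol r z z

/-- `r(z, w̄)` is the conjugate of `r(w, z̄)` for all `z, w`. -/
def IsHermitianSymm (r : BiPoly) : Prop :=
  ∀ z w : ℂ, pol r z w = conj (pol r w z)

/-- The squared norm `‖F(z)‖²` of a holomorphic polynomial mapping `F : ℂ → ℂ^N`. -/
noncomputable def sqNorm {N : ℕ} (F : Fin N → Polynomial ℂ) (z : ℂ) : ℝ :=
  ∑ j, ‖(F j).eval z‖ ^ 2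

/-- The Hermitian symmetric polynomials that are squared norms of holomorphic
polynomial mappings. -/
def PInfty : Set BiPoly :=
  {r | IsHermitianSymm r ∧
    ∃ (N : ℕ) (F : Fin N → Polynomial ℂ), ∀ z : ℂ, val r z = (sqNorm F z : ℂ)}

/-- The Hermitian symmetric polynomials that are quotients of squared norms: `r = p / q` with
`p, q` squared norms and `q` not identically zero, the quotient being taken
wherever the denominator does not vanish. -/
def Q : Set BiPoly :=
  {r | IsHermitianSymm r ∧
    ∃ p ∈ PInfty, ∃ q ∈ PInfty, q ≠ 0 ∧
      ∀ z : ℂ, val q z ≠ 0 → val r z = val p z / val q z}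

/-- `s` is Hermitian symmetric and its (real) values `s(z, z̄)` are all positive. -/
def IsStrictlyPositive (s : BiPoly) : Prop :=
  IsHermitianSymm s ∧ ∀ z : ℂ, 0 < (val s z).re

/-- The polynomial `|z - p|² = (z - p)(z̄ - p̄)`. -/
noncomputable def absSqSub (p : ℂ) : BiPoly :=
  (MvPolynomial.X 0 - MvPolynomial.C p) * (MvPolynomial.X 1 - MvPolynomial.C (conj p))

end HermPoly

/-!
Let `s` be strictly positive, of degree `d` in each of `z` and `z̄`. On homogeneous polynomials of
degree `N + d` in two variables, rewrite each `z^a ∂^b` with the derivatives to the left. Pairing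
with the kernel `(ū z + v)^(N + d)` turns this into an integral over the unit sphere of `ℂ²`,
`c (1 + |z|²)^N s(z, z̄) = ∫ σ_N(u, v) |ū z + v|^(2(N + d))`,
where the symbol `σ_N` converges uniformly, as `N → ∞`, to the bihomogenization of `s`. The latter
is positive on the sphere: at the point at infinity its value is the coefficient of `z^d z̄^d`,
which the degree condition makes nonzero. So `σ_N > 0` for large `N`, the integral is a positive
semidefinite Hermitian form in the powers of `z`, and `(1 + |z|²)^N s` is a squared norm.

Conversely, let `r ‖G‖² = ‖F‖²`. A common zero `p` of `F` splits off `|z - p|²`, which divides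
`‖G‖²` or, by primality of `z - p` and Hermitian symmetry, `r`. Once `F` has no zeros, `r` is
positive, and its degree condition follows from that of squared norms: the top coefficient of a
squared norm, at `z^d z̄^d`, is a sum of squared moduli.
-/

namespace HermPoly

open MeasureTheory Filter Topology

section NormalOrdering

open Finset.HasAntidiagonal (antidiagonal mem_antidiagonal)

/-- The coefficients of the rewriting `z^a ∂^b = ∑ₛ antiNormalCoeff a b s • ∂^(b-s) z^(a-s)`. -/
def antiNormalCoeff (a b s : ℕ) : ℤ := (-1) ^ s * a.choose s * b.descFactorial s

theorem antiNormalCoeff_eq_zero {a b s : ℕ} (h : b < s) : antiNormalCoeff a b s = 0 := by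
  simp [antiNormalCoeff, Nat.descFactorial_eq_zero_iff_lt.2 h]

theorem sum_antidiagonal_neg_one_pow_mul_choose_mul_choose {a b i j : ℕ} (h : i + a = j + b) :
    ∑ st ∈ antidiagonal a, ((-1) ^ st.1 * b.choose st.1 * (i + st.2).choose st.2 : ℤ) =
      j.choose a := by
  have hneg (x n : ℤ) (t : ℕ) (hn : x + t - 1 = n) :
      Ring.choose (-x) t = (-1) ^ t * Ring.choose n t := by
    rw [Ring.choose_neg, hn, Units.smul_def, Int.coe_negOnePow_natCast, smul_eq_mul]
  have hVandermonde := Ring.add_choose_eq a (Commute.all (b : ℤ) (-(i + 1)))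
  rw [show (b : ℤ) + -(i + 1) = -(i + 1 - b) by ring, hneg _ j a (by lia),
    Ring.choose_natCast] at hVandermonde
  calc _ = (-1) ^ a * ∑ st ∈ antidiagonal a,
        Ring.choose (b : ℤ) st.1 * Ring.choose (-(i + 1) : ℤ) st.2 := by
        rw [Finset.mul_sum]
        refine Finset.sum_congr rfl fun st hst => ?_
        rw [hneg _ (i + st.2 : ℕ) _ (by push_cast; ring), Ring.choose_natCast,
          Ring.choose_natCast, ← mem_antidiagonal.1 hst]
        have hsign : ((-1) ^ (2 * st.2) : ℤ) = 1 := (even_two_mul _).neg_one_pow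
        linear_combination
          -((-1) ^ st.1 * b.choose st.1 * (i + st.2).choose st.2 : ℤ) * hsign
    _ = _ := by
        rw [← hVandermonde, ← mul_assoc, ← pow_add, (Even.add_self a).neg_one_pow, one_mul]

theorem sum_antiNormalCoeff_mul_factorial {a b i j : ℕ} (h : i + a = j + b) :
    ∑ s ∈ Finset.range (a + 1), antiNormalCoeff a b s * ((i + a - s).factorial : ℤ) =
      i.factorial * j.descFactorial a := by
  have hterm : ∀ st ∈ antidiagonal a,
      antiNormalCoeff a b st.1 * ((i + a - st.1).factorial : ℤ) = i.factorial * a.factorial *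
        ((-1) ^ st.1 * b.choose st.1 * (i + st.2).choose st.2) := by
    rintro ⟨s, t⟩ hst
    obtain rfl : s + t = a := mem_antidiagonal.1 hst
    have hs := Nat.add_choose_mul_factorial_mul_factorial s t
    have hi := Nat.add_choose_mul_factorial_mul_factorial i t
    rw [antiNormalCoeff, Nat.descFactorial_eq_factorial_mul_choose,
      show i + (s + t) - s = i + t by omega, ← hs, ← hi, Nat.choose_symm_add,
      ← Nat.choose_symm_add (a := i)]
    push_cast
    ring
  rw [← Finset.Nat.sum_antidiagonal_eq_sum_range_succ
      fun s _ => antiNormalCoeff a b s * ((i + a - s).factorial : ℤ),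
    Finset.sum_congr rfl hterm, ← Finset.mul_sum,
    sum_antidiagonal_neg_one_pow_mul_choose_mul_choose h,
    Nat.descFactorial_eq_factorial_mul_choose]
  push_cast
  ring

theorem choose_mul_descFactorial_mul_descFactorial {N d a k : ℕ} (ha : a ≤ d) (hk : k ≤ N) :
    (N + d).choose (a + k) * ((a + k).descFactorial a * (N + d - (a + k)).descFactorial (d - a)) =
      (N + d).descFactorial d * N.choose k := by
  have hchoose := Nat.choose_mul_factorial_mul_factorial (show a + k ≤ N + d by omega)
  have hchoose' := Nat.choose_mul_factorial_mul_factorial hk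
  have hdesc := Nat.factorial_mul_descFactorial (show a ≤ a + k by omega)
  have hdesc' := Nat.factorial_mul_descFactorial (show d - a ≤ N + d - (a + k) by omega)
  have hdesc'' := Nat.factorial_mul_descFactorial (show d ≤ N + d by omega)
  rw [show a + k - a = k by omega] at hdesc
  rw [show N + d - (a + k) - (d - a) = N - k by omega] at hdesc'
  rw [show N + d - d = N by omega] at hdesc''
  refine Nat.eq_of_mul_eq_mul_right
    (Nat.mul_pos (Nat.factorial_pos k) (Nat.factorial_pos (N - k))) ?_
  calc _ = (N + d).choose (a + k) * (k.factorial * (a + k).descFactorial a) *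
        ((N - k).factorial * (N + d - (a + k)).descFactorial (d - a)) := by ring
    _ = N.factorial * (N + d).descFactorial d := by rw [hdesc, hdesc', hchoose, hdesc'']
    _ = _ := by rw [← hchoose']; ring

end NormalOrdering

section Sphere

/-- The first coordinate of a parametrization of the unit sphere of `ℂ²` modulo the phase of the
second coordinate, which is taken to be nonnegative. -/
noncomputable def sphereFst (p : ℝ × ℝ) : ℂ := (√p.1 : ℂ) * Complex.exp (p.2 * Complex.I)

/-- The second coordinate of the parametrization of the unit sphere of `ℂ²`. -/
noncomputable def sphereSnd (p : ℝ × ℝ) : ℂ := (√(1 - p.1) : ℂ)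

/-- The parameters of the unit sphere. Lebesgue measure on this rectangle is, up to scaling, the
rotation invariant measure on the sphere. -/
def sphereDomain : Set (ℝ × ℝ) := Set.Icc 0 1 ×ˢ Set.Icc 0 (2 * Real.pi)

/-- The function `u^k ū^l v^n` of the point `(u, v)` of the sphere. As `v` is real, `v` and `v̄`
share one exponent. -/
noncomputable def sphereMonomial (k l n : ℕ) (p : ℝ × ℝ) : ℂ :=
  sphereFst p ^ k * conj (sphereFst p) ^ l * sphereSnd p ^ n

theorem conj_sphereSnd (p : ℝ × ℝ) : conj (sphereSnd p) = sphereSnd p := by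
  simp [sphereSnd]

@[fun_prop]
theorem continuous_sphereFst : Continuous sphereFst := by unfold sphereFst; fun_prop

@[fun_prop]
theorem continuous_sphereSnd : Continuous sphereSnd := by unfold sphereSnd; fun_prop

@[fun_prop]
theorem continuous_sphereMonomial (k l n : ℕ) : Continuous (sphereMonomial k l n) := by
  unfold sphereMonomial; fun_prop

theorem sphereMonomial_mul (k l n k' l' n' : ℕ) (p : ℝ × ℝ) :
    sphereMonomial k l n p * sphereMonomial k' l' n' p =
      sphereMonomial (k + k') (l + l') (n + n') p := by
  simp only [sphereMonomial]
  ring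

theorem isCompact_sphereDomain : IsCompact sphereDomain := isCompact_Icc.prod isCompact_Icc

theorem integrableOn_sphereDomain {f : ℝ × ℝ → ℂ} (hf : Continuous f) :
    IntegrableOn f sphereDomain :=
  hf.continuousOn.integrableOn_compact isCompact_sphereDomain

theorem integral_sphereMonomial_eq_mul (k l n : ℕ) :
    ∫ p in sphereDomain, sphereMonomial k l n p =
      (∫ x in (0 : ℝ)..1, ((√x ^ (k + l) * √(1 - x) ^ n : ℝ) : ℂ)) *
        ∫ θ in (0 : ℝ)..(2 * Real.pi), Complex.exp ((((k : ℤ) - l : ℤ) : ℂ) * Complex.I * θ) := by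
  rw [intervalIntegral.integral_of_le zero_le_one,
    intervalIntegral.integral_of_le Real.two_pi_pos.le, ← integral_Icc_eq_integral_Ioc,
    ← integral_Icc_eq_integral_Ioc, ← setIntegral_prod_mul, ← Measure.volume_eq_prod]
  congr 1
  ext p
  have hconj : conj (sphereFst p) = (√p.1 : ℂ) * Complex.exp (-(p.2 * Complex.I)) := by
    simp [sphereFst, ← Complex.exp_conj]
  have hexp : Complex.exp ((((k : ℤ) - l : ℤ) : ℂ) * Complex.I * p.2) =
      Complex.exp (p.2 * Complex.I) ^ k * Complex.exp (-(p.2 * Complex.I)) ^ l := by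
    rw [← Complex.exp_nat_mul, ← Complex.exp_nat_mul, ← Complex.exp_add]
    congr 1; push_cast; ring
  rw [sphereMonomial, hconj, hexp, sphereFst, sphereSnd]
  push_cast
  ring

theorem integral_sphereMonomial_of_ne {k l : ℕ} (n : ℕ) (h : k ≠ l) :
    ∫ p in sphereDomain, sphereMonomial k l n p = 0 := by
  have hc : (((k : ℤ) - l : ℤ) : ℂ) * Complex.I ≠ 0 :=
    mul_ne_zero (Int.cast_ne_zero.2 (by omega)) Complex.I_ne_zero
  have hperiod : (((k : ℤ) - l : ℤ) : ℂ) * Complex.I * ((2 * Real.pi : ℝ) : ℂ) =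
      (((k : ℤ) - l : ℤ) : ℂ) * (2 * Real.pi * Complex.I) := by push_cast; ring
  rw [integral_sphereMonomial_eq_mul, integral_exp_mul_complex hc, hperiod,
    Complex.exp_int_mul_two_pi_mul_I]
  simp

theorem integral_sphereMonomial_self (k m : ℕ) :
    ∫ p in sphereDomain, sphereMonomial k k (2 * m) p =
      2 * Real.pi * (k.factorial * m.factorial) / (k + m + 1).factorial := by
  have hbeta : ∫ x in (0 : ℝ)..1, ((√x ^ (k + k) * √(1 - x) ^ (2 * m) : ℝ) : ℂ) =
      Complex.betaIntegral (k + 1) (m + 1) := by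
    refine intervalIntegral.integral_congr fun x hx => ?_
    rw [Set.uIcc_of_le zero_le_one] at hx
    simp only [add_sub_cancel_right, Complex.cpow_natCast]
    rw [← two_mul, pow_mul, pow_mul, Real.sq_sqrt hx.1, Real.sq_sqrt (sub_nonneg.2 hx.2)]
    push_cast
    rfl
  have hre (n : ℕ) : 0 < ((n : ℂ) + 1).re := by
    simpa only [Complex.add_re, Complex.natCast_re, Complex.one_re] using n.cast_add_one_pos
  rw [integral_sphereMonomial_eq_mul, hbeta,
    Complex.betaIntegral_eq_Gamma_mul_div _ _ (hre k) (hre m), Complex.Gamma_nat_eq_factorial,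
    Complex.Gamma_nat_eq_factorial, show (k + 1 + (m + 1) : ℂ) = (k + m + 1 : ℕ) + 1 by
      push_cast; ring, Complex.Gamma_nat_eq_factorial]
  simp
  ring

end Sphere

section ToeplitzSymbol

/-- The anti-normal ordering of `u^a ∂_u^b v^(d-a) ∂_v^(d-b)`, read as a function on the sphere by
replacing `∂_u` and `∂_v` with `ū` and `v̄` and weighting by `α k` the terms with `k` contractions.
The contraction-free weight `Pi.single 0 1` gives the homogenization of `z^a z̄^b`. -/
noncomputable def toeplitzMonomial (α : ℕ → ℝ) (d a b : ℕ) (p : ℝ × ℝ) : ℂ :=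
  ∑ st ∈ Finset.range (a + 1) ×ˢ Finset.range (d - a + 1),
    (antiNormalCoeff a b st.1 * antiNormalCoeff (d - a) (d - b) st.2 * α (st.1 + st.2) : ℂ) *
      sphereMonomial (a - st.1) (b - st.1) ((d - a - st.2) + (d - b - st.2)) p

/-- The linear extension of `toeplitzMonomial` to polynomials with exponents at most `d`. -/
noncomputable def toeplitzSymbol (α : ℕ → ℝ) (d : ℕ) (r : BiPoly) (p : ℝ × ℝ) : ℂ :=
  ∑ m ∈ r.support, r.coeff m * toeplitzMonomial α d (m 0) (m 1) p

/-- The weight for which `toeplitzMonomial` represents its differential operator on homogeneous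
polynomials of degree `D`, when `n = D + d + 1`. -/
noncomputable def contractionWeight (n k : ℕ) : ℝ := (n.descFactorial k : ℝ)⁻¹

/-- The coefficient of `z^i` in `(ū z + v)^D`. -/
noncomputable def sphereBinomial (D i : ℕ) (p : ℝ × ℝ) : ℂ :=
  D.choose i * conj (sphereFst p) ^ i * sphereSnd p ^ (D - i)

@[fun_prop]
theorem continuous_toeplitzMonomial (α : ℕ → ℝ) (d a b : ℕ) :
    Continuous (toeplitzMonomial α d a b) := by
  unfold toeplitzMonomial; fun_prop

@[fun_prop]
theorem continuous_toeplitzSymbol (α : ℕ → ℝ) (d : ℕ) (r : BiPoly) :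
    Continuous (toeplitzSymbol α d r) := by
  unfold toeplitzSymbol; fun_prop

@[fun_prop]
theorem continuous_sphereBinomial (D i : ℕ) : Continuous (sphereBinomial D i) := by
  unfold sphereBinomial; fun_prop

theorem sphereBinomial_mul_conj (D i j : ℕ) (p : ℝ × ℝ) :
    sphereBinomial D i p * conj (sphereBinomial D j p) =
      (D.choose i * D.choose j : ℂ) * sphereMonomial j i ((D - j) + (D - i)) p := by
  simp only [sphereBinomial, sphereMonomial, map_mul, map_pow, map_natCast, Complex.conj_conj,
    conj_sphereSnd]
  ring

theorem sum_sphereBinomial_mul_pow (D : ℕ) (p : ℝ × ℝ) (z : ℂ) :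
    ∑ i ∈ Finset.range (D + 1), sphereBinomial D i p * z ^ i =
      (conj (sphereFst p) * z + sphereSnd p) ^ D := by
  rw [add_pow]
  refine Finset.sum_congr rfl fun i _ => ?_
  rw [sphereBinomial]
  ring

theorem integral_toeplitzTerm {D d a b i j s t : ℕ} (ha : a ≤ d) (hb : b ≤ d)
    (hi : i ≤ D) (hj : j ≤ D) (hs : s ≤ a) (ht : t ≤ d - a) :
    (antiNormalCoeff a b s * antiNormalCoeff (d - a) (d - b) t *
        contractionWeight (D + d + 1) (s + t) : ℂ) *
      ∫ p in sphereDomain, sphereMonomial (a - s + j) (b - s + i)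
        ((d - a - t) + (d - b - t) + ((D - j) + (D - i))) p =
    if j + a = i + b then (2 * Real.pi / (D + d + 1).factorial *
      ((antiNormalCoeff a b s * (j + a - s).factorial) *
        (antiNormalCoeff (d - a) (d - b) t * (D - j + (d - a) - t).factorial)) : ℂ) else 0 := by
  rcases lt_or_ge b s with hbs | hbs
  · simp [antiNormalCoeff_eq_zero hbs]
  rcases lt_or_ge (d - b) t with hbt | hbt
  · simp [antiNormalCoeff_eq_zero hbt]
  split_ifs with h
  · have hfactorial := Nat.factorial_mul_descFactorial (show s + t ≤ D + d + 1 by omega)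
    rw [show b - s + i = a - s + j by omega,
      show (d - a - t) + (d - b - t) + ((D - j) + (D - i)) = 2 * (D - j + (d - a) - t) by omega,
      integral_sphereMonomial_self, show a - s + j = j + a - s by omega,
      show j + a - s + (D - j + (d - a) - t) + 1 = D + d + 1 - (s + t) by omega,
      contractionWeight, ← hfactorial]
    push_cast
    field_simp
  · rw [integral_sphereMonomial_of_ne _ (by omega), mul_zero]

theorem integral_toeplitzMonomial_mul_sphereMonomial {D d a b i j : ℕ} (ha : a ≤ d) (hb : b ≤ d)
    (hi : i ≤ D) (hj : j ≤ D) :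
    ∫ p in sphereDomain, toeplitzMonomial (contractionWeight (D + d + 1)) d a b p *
      sphereMonomial j i ((D - j) + (D - i)) p =
    if j + a = i + b then (2 * Real.pi / (D + d + 1).factorial *
      ((j.factorial * i.descFactorial a) *
        ((D - j).factorial * (D - i).descFactorial (d - a))) : ℂ) else 0 := by
  simp_rw [toeplitzMonomial, Finset.sum_mul, mul_assoc _ (sphereMonomial _ _ _ _),
    sphereMonomial_mul]
  rw [integral_finsetSum _ fun st _ => integrableOn_sphereDomain (by fun_prop)]
  simp_rw [integral_const_mul]
  rw [Finset.sum_congr rfl fun st hst => integral_toeplitzTerm ha hb hi hj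
    (Finset.mem_range_succ_iff.1 (Finset.mem_product.1 hst).1)
    (Finset.mem_range_succ_iff.1 (Finset.mem_product.1 hst).2)]
  split_ifs with h
  · have hu := sum_antiNormalCoeff_mul_factorial h
    have hv := sum_antiNormalCoeff_mul_factorial
      (show D - j + (d - a) = D - i + (d - b) by omega)
    rw [← Finset.mul_sum, Finset.sum_product]
    simp only [← Finset.sum_mul_sum]
    congr 2
    · exact_mod_cast hu
    · exact_mod_cast hv
  · exact Finset.sum_const_zero

theorem integral_toeplitzMonomial_mul_sphereBinomial {N d a b k : ℕ} (ha : a ≤ d) (hb : b ≤ d)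
    (hk : k ≤ N) :
    ∫ p in sphereDomain, toeplitzMonomial (contractionWeight (N + d + d + 1)) d a b p *
      (sphereBinomial (N + d) (a + k) p * conj (sphereBinomial (N + d) (b + k) p)) =
    2 * Real.pi * (N + d).factorial * (N + d).descFactorial d / (N + d + d + 1).factorial *
      N.choose k := by
  have hchoose := Nat.choose_mul_factorial_mul_factorial (show b + k ≤ N + d by omega)
  have hdesc := choose_mul_descFactorial_mul_descFactorial ha hk
  simp_rw [sphereBinomial_mul_conj, mul_left_comm _ ((_ * _ : ℂ))]
  rw [integral_const_mul, integral_toeplitzMonomial_mul_sphereMonomial ha hb (by omega) (by omega),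
    if_pos (by omega)]
  calc (_ : ℂ) = 2 * Real.pi / (N + d + d + 1).factorial *
        (((N + d).choose (b + k) * (b + k).factorial * (N + d - (b + k)).factorial : ℕ) *
          ((N + d).choose (a + k) * ((a + k).descFactorial a *
            (N + d - (a + k)).descFactorial (d - a)) : ℕ)) := by push_cast; ring
    _ = _ := by rw [hchoose, hdesc]; push_cast; ring

theorem integral_toeplitzMonomial_mul_sphereBinomial_eq_zero {N d a b i j : ℕ} (ha : a ≤ d)
    (hb : b ≤ d) (hi : i ≤ N + d) (hj : j ≤ N + d)
    (hij : ∀ k ≤ N, (i, j) ≠ (a + k, b + k)) :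
    ∫ p in sphereDomain, toeplitzMonomial (contractionWeight (N + d + d + 1)) d a b p *
      (sphereBinomial (N + d) i p * conj (sphereBinomial (N + d) j p)) = 0 := by
  simp_rw [sphereBinomial_mul_conj, mul_left_comm _ ((_ * _ : ℂ))]
  rw [integral_const_mul, integral_toeplitzMonomial_mul_sphereMonomial ha hb hi hj]
  split_ifs with h
  · rcases lt_or_ge i a with hia | hia
    · simp [Nat.descFactorial_eq_zero_iff_lt.2 hia]
    · have hlt : N + d - i < d - a := by
        by_contra! hle
        exact hij (i - a) (by omega) (Prod.ext (by simp; omega) (by simp; omega))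
      simp [Nat.descFactorial_eq_zero_iff_lt.2 hlt]
  · simp

end ToeplitzSymbol

section ToeplitzKernel

/-- The eigenvalue of `toeplitzMonomial` on kernels of degree `N + d` in
`integral_toeplitzSymbol_mul_kernel`. -/
noncomputable def toeplitzConst (N d : ℕ) : ℝ :=
  2 * Real.pi * (N + d).factorial * (N + d).descFactorial d / (N + d + d + 1).factorial

theorem toeplitzConst_pos (N d : ℕ) : 0 < toeplitzConst N d := by
  have hdesc : 0 < (N + d).descFactorial d := Nat.descFactorial_pos.2 (Nat.le_add_left d N)
  unfold toeplitzConst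
  positivity

theorem integral_toeplitzMonomial_mul_kernel {N d a b : ℕ} (ha : a ≤ d) (hb : b ≤ d) (z : ℂ) :
    ∫ p in sphereDomain, toeplitzMonomial (contractionWeight (N + d + d + 1)) d a b p *
      ((conj (sphereFst p) * z + sphereSnd p) ^ (N + d) *
        conj ((conj (sphereFst p) * z + sphereSnd p) ^ (N + d))) =
    toeplitzConst N d * (1 + z * conj z) ^ N * (z ^ a * conj z ^ b) := by
  have hexpand (p : ℝ × ℝ) : toeplitzMonomial (contractionWeight (N + d + d + 1)) d a b p *
      ((conj (sphereFst p) * z + sphereSnd p) ^ (N + d) *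
        conj ((conj (sphereFst p) * z + sphereSnd p) ^ (N + d))) =
      ∑ ij ∈ Finset.range (N + d + 1) ×ˢ Finset.range (N + d + 1),
        z ^ ij.1 * conj z ^ ij.2 * (toeplitzMonomial (contractionWeight (N + d + d + 1)) d a b p *
          (sphereBinomial (N + d) ij.1 p * conj (sphereBinomial (N + d) ij.2 p))) := by
    rw [← sum_sphereBinomial_mul_pow, map_sum, Finset.sum_mul_sum, ← Finset.sum_product',
      Finset.mul_sum]
    refine Finset.sum_congr rfl fun ij _ => ?_
    rw [map_mul, map_pow]
    ring
  simp_rw [hexpand]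
  rw [integral_finsetSum _ fun ij _ => integrableOn_sphereDomain (by fun_prop)]
  simp_rw [integral_const_mul]
  symm
  rw [mul_right_comm, add_comm 1, add_pow, Finset.mul_sum]
  refine Finset.sum_of_injOn (fun k => (a + k, b + k)) ?_ ?_ ?_ ?_
  · exact fun k _ l _ h => Nat.add_left_cancel (Prod.ext_iff.1 h).1
  · intro k hk
    simp only [Finset.coe_range, Set.mem_Iio, Finset.coe_product, Set.mem_prod] at hk ⊢
    omega
  · intro ij hij hnot
    simp only [Finset.mem_product, Finset.mem_range] at hij
    rw [integral_toeplitzMonomial_mul_sphereBinomial_eq_zero ha hb (by omega) (by omega)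
      fun k hk h => hnot ⟨k, by simpa using Nat.lt_succ_of_le hk, h.symm⟩, mul_zero]
  · intro k hk
    rw [integral_toeplitzMonomial_mul_sphereBinomial ha hb (Finset.mem_range_succ_iff.1 hk),
      toeplitzConst]
    push_cast
    ring

theorem val_eq_sum (r : BiPoly) (z : ℂ) :
    val r z = ∑ m ∈ r.support, r.coeff m * (z ^ m 0 * conj z ^ m 1) := by
  simp [val, pol, MvPolynomial.eval_eq', Fin.prod_univ_two]

theorem integral_toeplitzSymbol_mul_kernel {d : ℕ} {r : BiPoly}
    (hd : ∀ m ∈ r.support, ∀ i, m i ≤ d) (N : ℕ) (z : ℂ) :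
    ∫ p in sphereDomain, toeplitzSymbol (contractionWeight (N + d + d + 1)) d r p *
      ((conj (sphereFst p) * z + sphereSnd p) ^ (N + d) *
        conj ((conj (sphereFst p) * z + sphereSnd p) ^ (N + d))) =
    toeplitzConst N d * ((1 + z * conj z) ^ N * val r z) := by
  simp_rw [toeplitzSymbol, Finset.sum_mul, mul_assoc (r.coeff _)]
  rw [integral_finsetSum _ fun m _ => integrableOn_sphereDomain (by fun_prop), val_eq_sum,
    Finset.mul_sum, Finset.mul_sum]
  refine Finset.sum_congr rfl fun m hm => ?_
  rw [integral_const_mul, integral_toeplitzMonomial_mul_kernel (hd m hm 0) (hd m hm 1)]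
  ring

end ToeplitzKernel

section Positivity

open scoped ComplexOrder

/-- The function `∑ c_ab u^a ū^b v^(d-a) v̄^(d-b)` on the sphere, for `r = ∑ c_ab z^a z̄^b`. -/
noncomputable def sphereHomogenization (d : ℕ) (r : BiPoly) (p : ℝ × ℝ) : ℂ :=
  ∑ m ∈ r.support, r.coeff m * sphereMonomial (m 0) (m 1) ((d - m 0) + (d - m 1)) p

@[fun_prop]
theorem continuous_sphereHomogenization (d : ℕ) (r : BiPoly) :
    Continuous (sphereHomogenization d r) := by
  unfold sphereHomogenization; fun_prop

theorem toeplitzSymbol_single (d : ℕ) (r : BiPoly) :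
    toeplitzSymbol (Pi.single 0 1) d r = sphereHomogenization d r := by
  ext p
  refine Finset.sum_congr rfl fun m _ => ?_
  rw [toeplitzMonomial, Finset.sum_eq_single (0, 0)]
  · simp [antiNormalCoeff]
  · rintro ⟨s, t⟩ - hst
    rw [Pi.single_eq_of_ne (by simpa using hst)]
    simp
  · simp

theorem tendsto_contractionWeight : Tendsto contractionWeight atTop (𝓝 (Pi.single 0 1)) := by
  refine tendsto_pi_nhds.2 fun k => ?_
  rcases k.eq_zero_or_pos with rfl | hk
  · simp [contractionWeight]
  · rw [Pi.single_eq_of_ne hk.ne']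
    refine tendsto_inv_atTop_zero.comp (tendsto_natCast_atTop_atTop.comp ?_)
    refine tendsto_atTop_mono (fun n => n.pow_sub_le_descFactorial k) ?_
    exact (tendsto_pow_atTop hk.ne').comp
      ((tendsto_sub_atTop_nat k).comp (tendsto_add_atTop_nat 1))

theorem eventually_toeplitzSymbol_re_pos {d : ℕ} {r : BiPoly}
    (hpos : ∀ p ∈ sphereDomain, 0 < sphereHomogenization d r p) :
    ∀ᶠ n in atTop, ∀ p ∈ sphereDomain, 0 < (toeplitzSymbol (contractionWeight n) d r p).re := by
  suffices hnhds : ∀ᶠ α in 𝓝 (Pi.single 0 1), ∀ p ∈ sphereDomain, 0 < (toeplitzSymbol α d r p).re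
    from tendsto_contractionWeight.eventually hnhds
  refine isCompact_sphereDomain.eventually_forall_of_forall_eventually fun p hp => ?_
  have hcont : Continuous fun αp : (ℕ → ℝ) × (ℝ × ℝ) => (toeplitzSymbol αp.1 d r αp.2).re := by
    unfold toeplitzSymbol toeplitzMonomial
    fun_prop
  refine hcont.continuousAt.eventually_const_lt ?_
  simpa only [toeplitzSymbol_single] using (Complex.pos_iff.1 (hpos p hp)).1

theorem IsHermitianSymm.val_im {r : BiPoly} (hr : IsHermitianSymm r) (z : ℂ) :
    (val r z).im = 0 :=
  Complex.conj_eq_iff_im.1 (hr z z).symm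

theorem IsStrictlyPositive.val_pos {s : BiPoly} (hs : IsStrictlyPositive s) (z : ℂ) :
    0 < val s z :=
  Complex.pos_iff.2 ⟨hs.2 z, (hs.1.val_im z).symm⟩

theorem IsStrictlyPositive.val_ne_zero {s : BiPoly} (hs : IsStrictlyPositive s) (z : ℂ) :
    val s z ≠ 0 :=
  (hs.val_pos z).ne'

theorem sphereHomogenization_eq_val {d : ℕ} {r : BiPoly} (hd : ∀ m ∈ r.support, ∀ i, m i ≤ d)
    {p : ℝ × ℝ} (hp : sphereSnd p ≠ 0) :
    sphereHomogenization d r p = sphereSnd p ^ (2 * d) * val r (sphereFst p / sphereSnd p) := by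
  rw [val_eq_sum, sphereHomogenization, Finset.mul_sum]
  refine Finset.sum_congr rfl fun m hm => ?_
  have hexponents : sphereSnd p ^ (2 * d) =
      sphereSnd p ^ ((d - m 0) + (d - m 1)) * sphereSnd p ^ m 0 * sphereSnd p ^ m 1 := by
    rw [← pow_add, ← pow_add]
    congr 1
    have := hd m hm 0
    have := hd m hm 1
    omega
  rw [hexponents, map_div₀, conj_sphereSnd, sphereMonomial, div_pow, div_pow]
  field_simp

theorem sphereHomogenization_of_fst_eq_one {d : ℕ} {r : BiPoly} {m : Fin 2 →₀ ℕ}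
    (hd : ∀ m ∈ r.support, ∀ i, m i ≤ d) (hm : ∀ i, m i = d) {p : ℝ × ℝ} (hp : p.1 = 1) :
    sphereHomogenization d r p = r.coeff m := by
  have hsnd : sphereSnd p = 0 := by simp [sphereSnd, hp]
  have hfst : sphereFst p * conj (sphereFst p) = 1 := by
    simp [Complex.mul_conj', sphereFst, hp]
  rw [sphereHomogenization, Finset.sum_eq_single m]
  · simp [sphereMonomial, hm, ← mul_pow, hfst]
  · intro n hn hnm
    have hexponent : (d - n 0) + (d - n 1) ≠ 0 := fun h => hnm <| Finsupp.ext fun i => by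
      have := hd n hn 0
      have := hd n hn 1
      rw [hm]
      fin_cases i <;> simp only [Fin.zero_eta, Fin.mk_one] <;> omega
    rw [sphereMonomial, hsnd, zero_pow hexponent, mul_zero, mul_zero]
  · intro hm'
    rw [MvPolynomial.notMem_support_iff.1 hm', zero_mul]

theorem sphereHomogenization_pos {d : ℕ} {s : BiPoly} {m : Fin 2 →₀ ℕ} (hs : IsStrictlyPositive s)
    (hd : ∀ m ∈ s.support, ∀ i, m i ≤ d) (hm : m ∈ s.support) (hmd : ∀ i, m i = d)
    {p : ℝ × ℝ} (hp : p ∈ sphereDomain) : 0 < sphereHomogenization d s p := by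
  have hlt {q : ℝ × ℝ} (hq : q.1 < 1) : 0 < sphereHomogenization d s q := by
    have hsnd : 0 < sphereSnd q := Complex.zero_lt_real.2 (Real.sqrt_pos.2 (sub_pos.2 hq))
    rw [sphereHomogenization_eq_val hd hsnd.ne']
    exact mul_pos (pow_pos hsnd _) (hs.val_pos _)
  rcases hp.1.2.lt_or_eq with hp1 | hp1
  · exact hlt hp1
  · have hcont : Continuous fun x : ℝ => sphereHomogenization d s (x, p.2) := by fun_prop
    have hnonneg : 0 ≤ sphereHomogenization d s (1, p.2) :=
      ge_of_tendsto (hcont.continuousAt.continuousWithinAt (s := Set.Iio 1))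
        (eventually_mem_nhdsWithin.mono fun x (hx : x < 1) => (hlt hx).le)
    rw [← show p = (1, p.2) from Prod.ext hp1 rfl] at hnonneg
    refine hnonneg.lt_of_ne' ?_
    rw [sphereHomogenization_of_fst_eq_one hd hmd hp1]
    exact MvPolynomial.mem_support_iff.1 hm

end Positivity

section SquaredNorms

open scoped ComplexOrder

theorem exists_sqNorm_eq_sum_of_posSemidef {n : ℕ} {A : Matrix (Fin n) (Fin n) ℂ}
    (hA : A.PosSemidef) :
    ∃ (N : ℕ) (F : Fin N → Polynomial ℂ), ∀ z : ℂ,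
      ∑ i : Fin n, ∑ j : Fin n, z ^ (i : ℕ) * conj (z ^ (j : ℕ)) * A i j = sqNorm F z := by
  obtain ⟨N, v, rfl⟩ := Matrix.posSemidef_iff_eq_sum_vecMulVec.1 hA
  refine ⟨N, fun l => ∑ i : Fin n, Polynomial.monomial i (v l i), fun z => ?_⟩
  simp only [sqNorm, Complex.ofReal_sum, Complex.ofReal_pow, ← Complex.mul_conj',
    Polynomial.eval_finsetSum, Polynomial.eval_monomial, map_sum, map_mul, Matrix.sum_apply,
    Matrix.vecMulVec_apply, Pi.star_apply, RCLike.star_def, Finset.mul_sum, Finset.sum_mul]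
  rw [Finset.sum_comm_cycle]
  refine Finset.sum_congr rfl fun l _ => ?_
  rw [Finset.sum_comm]
  refine Finset.sum_congr rfl fun j _ => Finset.sum_congr rfl fun i _ => ?_
  ring

variable {X : Type*} [MeasurableSpace X] {μ : Measure X} {n : ℕ} {w : X → ℝ} {φ : Fin n → X → ℂ}

theorem integral_weight_mul_sum_mul_conj
    (hint : ∀ i j, Integrable (fun x => w x * (φ i x * conj (φ j x))) μ) (c : Fin n → ℂ) :
    ∫ x, w x * ((∑ i, φ i x * c i) * conj (∑ i, φ i x * c i)) ∂μ =
      ∑ i, ∑ j, c i * conj (c j) * ∫ x, w x * (φ i x * conj (φ j x)) ∂μ := by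
  have hexpand (x : X) : w x * ((∑ i, φ i x * c i) * conj (∑ i, φ i x * c i)) =
      ∑ i, ∑ j, c i * conj (c j) * (w x * (φ i x * conj (φ j x))) := by
    rw [map_sum, Finset.sum_mul_sum, Finset.mul_sum]
    refine Finset.sum_congr rfl fun i _ => ?_
    rw [Finset.mul_sum]
    refine Finset.sum_congr rfl fun j _ => ?_
    rw [map_mul]
    ring
  simp_rw [hexpand]
  rw [integral_finsetSum _ fun i _ => integrable_finsetSum _ fun j _ => (hint i j).const_mul _]
  refine Finset.sum_congr rfl fun i _ => ?_
  rw [integral_finsetSum _ fun j _ => (hint i j).const_mul _]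
  exact Finset.sum_congr rfl fun j _ => integral_const_mul _ _

theorem posSemidef_integral_weight_mul (hw : 0 ≤ᵐ[μ] w)
    (hint : ∀ i j, Integrable (fun x => w x * (φ i x * conj (φ j x))) μ) :
    (Matrix.of fun i j => ∫ x, w x * (φ i x * conj (φ j x)) ∂μ).PosSemidef := by
  refine Matrix.PosSemidef.of_dotProduct_mulVec_nonneg ?_ fun c => ?_
  · ext i j
    rw [Matrix.conjTranspose_apply, Matrix.of_apply, Matrix.of_apply, RCLike.star_def,
      ← integral_conj]
    simp only [map_mul, Complex.conj_ofReal, Complex.conj_conj, mul_comm (conj (φ j _))]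
  · have hquadratic :
        star c ⬝ᵥ (Matrix.of fun i j => ∫ x, w x * (φ i x * conj (φ j x)) ∂μ).mulVec c =
        ∫ x, w x * ((∑ i, φ i x * conj (c i)) * conj (∑ i, φ i x * conj (c i))) ∂μ := by
      rw [integral_weight_mul_sum_mul_conj hint fun i => conj (c i)]
      simp only [dotProduct, Matrix.mulVec, Finset.mul_sum, Pi.star_apply, RCLike.star_def,
        Matrix.of_apply, Complex.conj_conj, mul_assoc, mul_comm (c _)]
    rw [hquadratic]
    refine integral_nonneg_of_ae (hw.mono fun x hx => ?_)
    exact mul_nonneg (Complex.zero_le_real.2 hx) (mul_star_self_nonneg _)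

theorem exists_sqNorm_eq_integral (hw : 0 ≤ᵐ[μ] w)
    (hint : ∀ i j, Integrable (fun x => w x * (φ i x * conj (φ j x))) μ) :
    ∃ (N : ℕ) (F : Fin N → Polynomial ℂ), ∀ z : ℂ,
      ∫ x, w x * ((∑ i, φ i x * z ^ (i : ℕ)) * conj (∑ i, φ i x * z ^ (i : ℕ))) ∂μ =
        sqNorm F z := by
  simp_rw [integral_weight_mul_sum_mul_conj hint]
  exact exists_sqNorm_eq_sum_of_posSemidef (posSemidef_integral_weight_mul hw hint)

theorem integral_re_mul_mul_conj {f g : X → ℂ}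
    (hint : Integrable (fun x => f x * (g x * conj (g x))) μ) :
    ∫ x, ((f x).re : ℂ) * (g x * conj (g x)) ∂μ =
      ((∫ x, f x * (g x * conj (g x)) ∂μ).re : ℂ) := by
  have hre (x : X) : ((f x).re : ℂ) * (g x * conj (g x)) =
      ((f x * (g x * conj (g x))).re : ℂ) := by
    rw [Complex.mul_conj, Complex.re_mul_ofReal, Complex.ofReal_mul]
  simp_rw [hre]
  rw [integral_complex_ofReal]
  exact congrArg _ (integral_re hint)

theorem integral_re_toeplitzSymbol_mul_kernel {d : ℕ} {r : BiPoly} (hr : IsHermitianSymm r)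
    (hd : ∀ m ∈ r.support, ∀ i, m i ≤ d) (N : ℕ) (z : ℂ) :
    ∫ p in sphereDomain, (((toeplitzConst N d)⁻¹ *
        (toeplitzSymbol (contractionWeight (N + d + d + 1)) d r p).re : ℝ) : ℂ) *
      ((conj (sphereFst p) * z + sphereSnd p) ^ (N + d) *
        conj ((conj (sphereFst p) * z + sphereSnd p) ^ (N + d))) =
    (1 + z * conj z) ^ N * val r z := by
  have hreal : (1 + z * conj z) ^ N * val r z = (((1 + ‖z‖ ^ 2) ^ N * (val r z).re : ℝ) : ℂ) := by
    have hval : ((val r z).re : ℂ) = val r z := Complex.conj_eq_iff_re.1 (hr z z).symm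
    rw [Complex.mul_conj', Complex.ofReal_mul, hval]
    push_cast
    rfl
  have hconst : (toeplitzConst N d : ℂ) ≠ 0 := Complex.ofReal_ne_zero.2 (toeplitzConst_pos N d).ne'
  simp_rw [Complex.ofReal_mul, mul_assoc]
  rw [integral_const_mul, integral_re_mul_mul_conj (integrableOn_sphereDomain (by fun_prop)),
    integral_toeplitzSymbol_mul_kernel hd, hreal, Complex.re_ofReal_mul, Complex.ofReal_re,
    Complex.ofReal_inv, Complex.ofReal_mul (toeplitzConst N d), inv_mul_cancel_left₀ hconst]

theorem IsStrictlyPositive.exists_sqNorm {d : ℕ} {s : BiPoly} {m : Fin 2 →₀ ℕ}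
    (hs : IsStrictlyPositive s) (hd : ∀ m ∈ s.support, ∀ i, m i ≤ d) (hm : m ∈ s.support)
    (hmd : ∀ i, m i = d) :
    ∃ (N n : ℕ) (F : Fin n → Polynomial ℂ), ∀ z : ℂ,
      (1 + z * conj z) ^ N * val s z = sqNorm F z := by
  obtain ⟨N, hN⟩ := eventually_atTop.1 <| eventually_toeplitzSymbol_re_pos fun p hp =>
    sphereHomogenization_pos hs hd hm hmd hp
  have hweight : ∀ᵐ p ∂volume.restrict sphereDomain, 0 ≤ (toeplitzConst N d)⁻¹ *
      (toeplitzSymbol (contractionWeight (N + d + d + 1)) d s p).re :=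
    ae_restrict_of_forall_mem isCompact_sphereDomain.measurableSet fun p hp =>
      mul_nonneg (inv_nonneg.2 (toeplitzConst_pos N d).le) (hN _ (by omega) p hp).le
  obtain ⟨n, F, hF⟩ := exists_sqNorm_eq_integral hweight
    (φ := fun i : Fin (N + d + 1) => sphereBinomial (N + d) i)
    fun i j => integrableOn_sphereDomain (by fun_prop)
  refine ⟨N, n, F, fun z => ?_⟩
  simp_rw [← integral_re_toeplitzSymbol_mul_kernel hs.1 hd, ← hF, ← sum_sphereBinomial_mul_pow,
    Finset.sum_range]

end SquaredNorms

section HermitianConjugation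

open MvPolynomial (X C)

/-- The involution `r(z, w̄) ↦ conj (r(w, z̄))`, whose fixed points are the Hermitian symmetric
polynomials. -/
noncomputable def hermConj : BiPoly →+* BiPoly :=
  (MvPolynomial.rename (Equiv.swap (0 : Fin 2) 1)).toRingHom.comp
    (MvPolynomial.map (starRingEnd ℂ))

theorem hermConj_apply (r : BiPoly) : hermConj r =
    MvPolynomial.rename (Equiv.swap (0 : Fin 2) 1) (MvPolynomial.map (starRingEnd ℂ) r) := rfl

theorem pol_hermConj (r : BiPoly) (z w : ℂ) : pol (hermConj r) z w = conj (pol r w z) := by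
  have hpoint : ![z, conj w] ∘ Equiv.swap (0 : Fin 2) 1 = starRingEnd ℂ ∘ ![w, conj z] := by
    ext i
    fin_cases i <;> simp
  rw [hermConj_apply, pol, pol, MvPolynomial.eval_rename, hpoint, MvPolynomial.map_eval]

theorem eq_of_pol_eq {r s : BiPoly} (h : ∀ z w, pol r z w = pol s z w) : r = s := by
  refine MvPolynomial.funext fun x => ?_
  have hx : ![x 0, conj (conj (x 1))] = x := by
    ext i
    fin_cases i <;> simp
  simpa only [pol, hx] using h (x 0) (conj (x 1))

theorem isHermitianSymm_iff {r : BiPoly} : IsHermitianSymm r ↔ hermConj r = r := by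
  refine ⟨fun h => eq_of_pol_eq fun z w => ?_, fun h z w => ?_⟩
  · rw [pol_hermConj, h z w]
  · rw [← pol_hermConj, h]

theorem IsHermitianSymm.mul {r s : BiPoly} (hr : IsHermitianSymm r) (hs : IsHermitianSymm s) :
    IsHermitianSymm (r * s) := by
  rw [isHermitianSymm_iff] at *
  rw [map_mul, hr, hs]

theorem IsHermitianSymm.pow {r : BiPoly} (hr : IsHermitianSymm r) (n : ℕ) :
    IsHermitianSymm (r ^ n) := by
  rw [isHermitianSymm_iff] at *
  rw [map_pow, hr]

theorem IsHermitianSymm.of_mul_left {r s : BiPoly} (hr : IsHermitianSymm r) (hr0 : r ≠ 0)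
    (hrs : IsHermitianSymm (r * s)) : IsHermitianSymm s := by
  rw [isHermitianSymm_iff] at *
  rw [map_mul, hr] at hrs
  exact mul_left_cancel₀ hr0 hrs

theorem degreeOf_one_hermConj (r : BiPoly) :
    MvPolynomial.degreeOf 1 (hermConj r) = MvPolynomial.degreeOf 0 r := by
  have hrename := MvPolynomial.degreeOf_rename_of_injective
    (p := MvPolynomial.map (starRingEnd ℂ) r) (Equiv.swap (0 : Fin 2) 1).injective 0
  rw [Equiv.swap_apply_left] at hrename
  rw [hermConj_apply, hrename, MvPolynomial.degreeOf_eq_sup, MvPolynomial.degreeOf_eq_sup,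
    MvPolynomial.support_map_of_injective _ (starRingEnd ℂ).injective]

theorem IsHermitianSymm.le_degreeOf_zero {r : BiPoly} (hr : IsHermitianSymm r) :
    ∀ m ∈ r.support, ∀ i, m i ≤ MvPolynomial.degreeOf 0 r := by
  refine fun m hm => Fin.forall_fin_two.2 ⟨MvPolynomial.monomial_le_degreeOf 0 hm, ?_⟩
  rw [← degreeOf_one_hermConj, isHermitianSymm_iff.1 hr]
  exact MvPolynomial.monomial_le_degreeOf 1 hm

theorem IsHermitianSymm.exists_mem_support_of_totalDegree_eq {r : BiPoly} (hr : IsHermitianSymm r)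
    (hr0 : r ≠ 0) (hdeg : MvPolynomial.totalDegree r = 2 * MvPolynomial.degreeOf 0 r) :
    ∃ m ∈ r.support, ∀ i, m i = MvPolynomial.degreeOf 0 r := by
  obtain ⟨m, hm, hsum⟩ := Finset.exists_mem_eq_sup r.support
    (MvPolynomial.support_nonempty.2 hr0) fun m => m.sum fun _ k => k
  refine ⟨m, hm, ?_⟩
  replace hsum : r.totalDegree = m 0 + m 1 := by
    rw [MvPolynomial.totalDegree, hsum, Finsupp.sum_fintype _ _ fun _ => rfl, Fin.sum_univ_two]
  have h0 := hr.le_degreeOf_zero m hm 0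
  have h1 := hr.le_degreeOf_zero m hm 1
  exact Fin.forall_fin_two.2 ⟨by omega, by omega⟩

theorem totalDegree_eq_two_mul_degreeOf_zero {r : BiPoly} {d : ℕ} {m : Fin 2 →₀ ℕ}
    (hd : ∀ m ∈ r.support, ∀ i, m i ≤ d) (hm : m ∈ r.support) (hmd : ∀ i, m i = d) :
    MvPolynomial.totalDegree r = 2 * MvPolynomial.degreeOf 0 r := by
  have hsum (n : Fin 2 →₀ ℕ) : (n.sum fun _ k => k) = n 0 + n 1 := by
    rw [Finsupp.sum_fintype _ _ fun _ => rfl, Fin.sum_univ_two]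
  have hdegreeOf : MvPolynomial.degreeOf 0 r = d :=
    le_antisymm (MvPolynomial.degreeOf_le_iff.2 fun n hn => hd n hn 0)
      (hmd 0 ▸ MvPolynomial.monomial_le_degreeOf 0 hm)
  rw [hdegreeOf]
  refine le_antisymm (Finset.sup_le fun n hn => ?_) ?_
  · have h0 := hd n hn 0
    have h1 := hd n hn 1
    rw [hsum]
    omega
  · have hle := MvPolynomial.le_totalDegree hm
    rwa [hsum, hmd, hmd, ← two_mul] at hle

theorem eq_zero_of_val_eq_zero {r : BiPoly} (h : ∀ z, val r z = 0) : r = 0 := by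
  -- In the real coordinates of `z = x + iy`, the diagonal `w = z` is all of `ℝ²`.
  let toReal : BiPoly →ₐ[ℂ] BiPoly :=
    MvPolynomial.aeval ![X 0 + C Complex.I * X 1, X 0 - C Complex.I * X 1]
  have heval (x : Fin 2 → ℂ) : MvPolynomial.eval x (toReal r) =
      MvPolynomial.eval ![x 0 + Complex.I * x 1, x 0 - Complex.I * x 1] r := by
    have hcomp : (MvPolynomial.eval x).comp toReal.toRingHom =
        MvPolynomial.eval ![x 0 + Complex.I * x 1, x 0 - Complex.I * x 1] := by
      refine MvPolynomial.ringHom_ext (fun c => by simp [toReal]) fun i => ?_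
      fin_cases i <;> simp [toReal]
    exact RingHom.congr_fun hcomp r
  have hreal : toReal r = 0 := by
    refine MvPolynomial.funext_set (fun _ => Set.range ((↑) : ℝ → ℂ))
      (fun _ => Set.infinite_range_of_injective Complex.ofReal_injective) fun x hx => ?_
    obtain ⟨a, ha⟩ := hx 0 trivial
    obtain ⟨b, hb⟩ := hx 1 trivial
    have hconj : conj ((a : ℂ) + Complex.I * b) = a - Complex.I * b := by simp [sub_eq_add_neg]
    rw [heval, ← ha, ← hb, ← hconj, map_zero]
    exact h _
  refine MvPolynomial.funext fun y => ?_
  have hy : ![(y 0 + y 1) / 2 + Complex.I * ((y 0 - y 1) / (2 * Complex.I)),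
      (y 0 + y 1) / 2 - Complex.I * ((y 0 - y 1) / (2 * Complex.I))] = y := by
    ext i
    fin_cases i <;> simp <;> field_simp <;> ring
  simpa only [hreal, map_zero, Matrix.cons_val_zero, Matrix.cons_val_one, hy, eq_comm] using
    heval ![(y 0 + y 1) / 2, (y 0 - y 1) / (2 * Complex.I)]

theorem eq_of_val_eq {r s : BiPoly} (h : ∀ z, val r z = val s z) : r = s :=
  sub_eq_zero.1 <| eq_zero_of_val_eq_zero fun z => by
    rw [val, pol, map_sub]
    exact sub_eq_zero.2 (h z)

end HermitianConjugation

section SquaredNormPolynomials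

open MvPolynomial (X C)

variable {M N : ℕ} {F : Fin N → Polynomial ℂ} {G : Fin M → Polynomial ℂ}

/-- A polynomial in `z`, viewed as a polynomial in `z` and `z̄`. -/
noncomputable def holo : Polynomial ℂ →ₐ[ℂ] BiPoly := Polynomial.aeval (X 0)

theorem val_hermConj (r : BiPoly) (z : ℂ) : val (hermConj r) z = conj (val r z) :=
  pol_hermConj r z z

theorem val_mul (r s : BiPoly) (z : ℂ) : val (r * s) z = val r z * val s z := map_mul ..

theorem val_holo (f : Polynomial ℂ) (z : ℂ) : val (holo f) z = f.eval z := by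
  rw [val, pol, ← MvPolynomial.coe_aeval_eq_eval, holo, RingHom.coe_coe,
    ← Polynomial.aeval_algHom_apply, MvPolynomial.aeval_X, Polynomial.coe_aeval_eq_eval]
  rfl

theorem holo_monomial (n : ℕ) (c : ℂ) :
    holo (Polynomial.monomial n c) = MvPolynomial.monomial (Finsupp.single 0 n) c := by
  rw [holo, Polynomial.aeval_monomial, MvPolynomial.algebraMap_eq,
    MvPolynomial.C_mul_X_pow_eq_monomial]

theorem hermConj_monomial_single_zero (n : ℕ) (c : ℂ) :
    hermConj (MvPolynomial.monomial (Finsupp.single 0 n) c) =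
      MvPolynomial.monomial (Finsupp.single 1 n) (conj c) := by
  rw [hermConj_apply, MvPolynomial.map_monomial, MvPolynomial.rename_monomial,
    Finsupp.mapDomain_single, Equiv.swap_apply_left]

theorem coeff_holo_mul_hermConj_holo (f g : Polynomial ℂ) (m : Fin 2 →₀ ℕ) :
    MvPolynomial.coeff m (holo f * hermConj (holo g)) = f.coeff (m 0) * conj (g.coeff (m 1)) := by
  induction f using Polynomial.induction_on' with
  | add f₁ f₂ h₁ h₂ => simp only [map_add, add_mul, MvPolynomial.coeff_add, Polynomial.coeff_add,
      h₁, h₂]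
  | monomial n a =>
    induction g using Polynomial.induction_on' with
    | add g₁ g₂ h₁ h₂ => simp only [map_add, mul_add, MvPolynomial.coeff_add, Polynomial.coeff_add,
        h₁, h₂]
    | monomial k b =>
      have hexponent : Finsupp.single 0 n + Finsupp.single 1 k = m ↔ n = m 0 ∧ k = m 1 := by
        simp [Finsupp.ext_iff, Fin.forall_fin_two]
      rw [holo_monomial, holo_monomial, hermConj_monomial_single_zero, MvPolynomial.monomial_mul,
        MvPolynomial.coeff_monomial, Polynomial.coeff_monomial, Polynomial.coeff_monomial]
      simp only [hexponent]
      split_ifs <;> simp_all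

/-- The squared norm `‖F‖²` of a holomorphic polynomial mapping, as a polynomial in `z` and `z̄`. -/
noncomputable def sqPoly (F : Fin N → Polynomial ℂ) : BiPoly :=
  ∑ j, holo (F j) * hermConj (holo (F j))

theorem val_sqPoly (F : Fin N → Polynomial ℂ) (z : ℂ) : val (sqPoly F) z = sqNorm F z := by
  have hterm (j : Fin N) : val (holo (F j) * hermConj (holo (F j))) z =
      (‖(F j).eval z‖ ^ 2 : ℝ) := by
    rw [val_mul, val_hermConj, val_holo, Complex.mul_conj', Complex.ofReal_pow]
  rw [sqNorm, Complex.ofReal_sum]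
  simp_rw [← hterm]
  exact map_sum ..

theorem isHermitianSymm_sqPoly (F : Fin N → Polynomial ℂ) : IsHermitianSymm (sqPoly F) := by
  have hinvolutive (r : BiPoly) : hermConj (hermConj r) = r :=
    eq_of_pol_eq fun z w => by rw [pol_hermConj, pol_hermConj, Complex.conj_conj]
  rw [isHermitianSymm_iff, sqPoly, map_sum]
  simp_rw [map_mul, hinvolutive, mul_comm]

theorem mem_PInfty_iff {r : BiPoly} :
    r ∈ PInfty ↔ ∃ (N : ℕ) (F : Fin N → Polynomial ℂ), r = sqPoly F := by
  constructor
  · rintro ⟨-, N, F, h⟩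
    exact ⟨N, F, eq_of_val_eq fun z => by rw [h, val_sqPoly]⟩
  · rintro ⟨N, F, rfl⟩
    exact ⟨isHermitianSymm_sqPoly F, N, F, val_sqPoly F⟩

theorem coeff_sqPoly (F : Fin N → Polynomial ℂ) (m : Fin 2 →₀ ℕ) :
    MvPolynomial.coeff m (sqPoly F) = ∑ j, (F j).coeff (m 0) * conj ((F j).coeff (m 1)) := by
  rw [sqPoly, MvPolynomial.coeff_sum]
  exact Finset.sum_congr rfl fun j _ => coeff_holo_mul_hermConj_holo _ _ _

theorem exists_ne_zero_and_forall_degree_le (hF : F ≠ 0) :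
    ∃ j, F j ≠ 0 ∧ ∀ i, (F i).degree ≤ (F j).degree := by
  obtain ⟨j₀, hj₀⟩ := Function.ne_iff.1 hF
  obtain ⟨j, -, hj⟩ := Finset.exists_max_image Finset.univ (fun i => (F i).degree)
    ⟨j₀, Finset.mem_univ _⟩
  refine ⟨j, fun hj0 => hj₀ ?_, fun i => hj i (Finset.mem_univ i)⟩
  simpa [hj0] using hj j₀ (Finset.mem_univ j₀)

theorem sqPoly_zero : sqPoly (0 : Fin N → Polynomial ℂ) = 0 := by
  simp [sqPoly]

theorem totalDegree_sqPoly (h : sqPoly F ≠ 0) :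
    (sqPoly F).totalDegree = 2 * (sqPoly F).degreeOf 0 := by
  obtain ⟨j, hj0, hmax⟩ := exists_ne_zero_and_forall_degree_le
    fun hF : F = 0 => h (hF ▸ sqPoly_zero)
  have hcoeff (n : ℕ) (hn : (F j).natDegree < n) (i : Fin N) : (F i).coeff n = 0 :=
    Polynomial.coeff_eq_zero_of_degree_lt <|
      (hmax i).trans_lt (Polynomial.natDegree_lt_iff_degree_lt hj0 |>.1 hn)
  let m : Fin 2 →₀ ℕ := Finsupp.equivFunOnFinite.symm fun _ => (F j).natDegree
  refine totalDegree_eq_two_mul_degreeOf_zero (d := (F j).natDegree) (m := m) ?_ ?_ fun _ => rfl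
  · intro n hn
    rw [MvPolynomial.mem_support_iff, coeff_sqPoly] at hn
    refine Fin.forall_fin_two.2 ⟨?_, ?_⟩ <;>
    · by_contra! hlt
      exact hn (by simp [hcoeff _ hlt])
  · have hlead : 0 < ‖(F j).coeff (F j).natDegree‖ ^ 2 :=
      pow_pos (norm_pos_iff.2 (Polynomial.leadingCoeff_ne_zero.2 hj0)) 2
    rw [MvPolynomial.mem_support_iff, coeff_sqPoly]
    change ∑ i, (F i).coeff (F j).natDegree * conj ((F i).coeff (F j).natDegree) ≠ 0
    simp_rw [Complex.mul_conj', ← Complex.ofReal_pow, ← Complex.ofReal_sum]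
    refine Complex.ofReal_ne_zero.2 (ne_of_gt ?_)
    exact Finset.sum_pos' (fun _ _ => sq_nonneg _) ⟨j, Finset.mem_univ _, hlead⟩

end SquaredNormPolynomials

section Factorization

open MvPolynomial (X C)

variable {M N : ℕ} {F : Fin N → Polynomial ℂ} {G : Fin M → Polynomial ℂ} {r : BiPoly} {p : ℂ}

theorem prime_X_zero_sub_C (p : ℂ) : Prime (X 0 - C p : BiPoly) := by
  have hequiv : MvPolynomial.finSuccEquiv ℂ 1 (X 0 - C p) = Polynomial.X - Polynomial.C (C p) := by
    simp [MvPolynomial.finSuccEquiv_apply]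
  rw [← MulEquiv.prime_iff (MvPolynomial.finSuccEquiv ℂ 1), hequiv]
  exact Polynomial.prime_X_sub_C _

theorem absSqSub_eq (p : ℂ) : absSqSub p = (X 0 - C p) * hermConj (X 0 - C p) := by
  simp [absSqSub, hermConj_apply]

theorem val_absSqSub (p z : ℂ) : val (absSqSub p) z = (z - p) * conj (z - p) := by
  simp [val, pol, absSqSub]

theorem val_absSqSub_eq_zero {z : ℂ} : val (absSqSub p) z = 0 ↔ z = p := by
  rw [val_absSqSub, Complex.mul_conj', pow_eq_zero_iff two_ne_zero, Complex.ofReal_eq_zero,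
    norm_eq_zero, sub_eq_zero]

theorem totalDegree_absSqSub_pos (p : ℂ) : 0 < (absSqSub p).totalDegree := by
  refine Nat.pos_of_ne_zero fun h => add_eq_left.not.2 one_ne_zero (?_ : p + 1 = p)
  obtain ⟨c, hc⟩ : ∃ c, absSqSub p = C c := ⟨_, MvPolynomial.totalDegree_eq_zero_iff_eq_C.1 h⟩
  have hconst (z : ℂ) : val (absSqSub p) z = c := by rw [hc, val, pol, MvPolynomial.eval_C]
  rw [← val_absSqSub_eq_zero, hconst, ← hconst p, val_absSqSub_eq_zero]

theorem absSqSub_ne_zero (p : ℂ) : absSqSub p ≠ 0 := by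
  intro h
  simpa [h] using totalDegree_absSqSub_pos p

theorem totalDegree_lt_totalDegree_absSqSub_mul (p : ℂ) (hr : r ≠ 0) :
    r.totalDegree < (absSqSub p * r).totalDegree := by
  rw [MvPolynomial.totalDegree_mul_of_isDomain (absSqSub_ne_zero p) hr]
  exact Nat.lt_add_of_pos_left (totalDegree_absSqSub_pos p)

theorem IsHermitianSymm.absSqSub_dvd (hr : IsHermitianSymm r) (h : X 0 - C p ∣ r) :
    absSqSub p ∣ r := by
  obtain ⟨t, rfl⟩ := h
  have hfixed := isHermitianSymm_iff.1 hr
  have hdvd : (X 0 - C p : BiPoly) ∣ hermConj (X 0 - C p) * hermConj t := by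
    rw [← map_mul, hfixed]
    exact dvd_mul_right _ _
  have hnot : ¬ (X 0 - C p : BiPoly) ∣ hermConj (X 0 - C p) := by
    rintro ⟨q, hq⟩
    have heval := congrArg (pol · p (p + 1)) hq
    simp [hermConj_apply, pol] at heval
  rw [← hfixed, map_mul, absSqSub_eq, mul_comm]
  exact mul_dvd_mul_left _ (((prime_X_zero_sub_C p).dvd_or_dvd hdvd).resolve_left hnot)

theorem absSqSub_dvd_of_mul_sqPoly {t : BiPoly} (hr : IsHermitianSymm r)
    (h : r * sqPoly G = absSqSub p * t) (hG : sqNorm G p ≠ 0) : absSqSub p ∣ r := by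
  have hdvd : X 0 - C p ∣ r * sqPoly G := by
    rw [h, absSqSub_eq, mul_assoc]
    exact dvd_mul_right _ _
  refine hr.absSqSub_dvd (((prime_X_zero_sub_C p).dvd_or_dvd hdvd).resolve_right ?_)
  rintro ⟨q, hq⟩
  have hval := val_sqPoly G p
  rw [hq, val_mul] at hval
  refine hG (Complex.ofReal_eq_zero.1 (hval.symm.trans ?_))
  simp [val, pol]

theorem sqPoly_X_sub_C_mul (F : Fin N → Polynomial ℂ) (p : ℂ) :
    sqPoly (fun j => (Polynomial.X - Polynomial.C p) * F j) = absSqSub p * sqPoly F := by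
  have hholo : holo (Polynomial.X - Polynomial.C p) = X 0 - C p := by
    simp [holo, MvPolynomial.algebraMap_eq]
  rw [sqPoly, sqPoly, Finset.mul_sum]
  refine Finset.sum_congr rfl fun j _ => ?_
  rw [map_mul, map_mul, hholo, absSqSub_eq]
  ring

theorem sqNorm_nonneg (F : Fin N → Polynomial ℂ) (z : ℂ) : 0 ≤ sqNorm F z :=
  Finset.sum_nonneg fun _ _ => sq_nonneg _

theorem exists_sqPoly_eq_absSqSub_mul (h : sqNorm F p = 0) :
    ∃ F' : Fin N → Polynomial ℂ, sqPoly F = absSqSub p * sqPoly F' := by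
  have hroot (j : Fin N) : (F j).IsRoot p := by
    simpa using (Finset.sum_eq_zero_iff_of_nonneg fun _ _ => sq_nonneg _).1 h j (Finset.mem_univ j)
  choose F' hF' using fun j => Polynomial.dvd_iff_isRoot.2 (hroot j)
  exact ⟨F', by rw [← sqPoly_X_sub_C_mul, ← funext hF']⟩

theorem isStrictlyPositive_of_mul_sqPoly (hr : IsHermitianSymm r) (h : r * sqPoly G = sqPoly F)
    (hF : ∀ z, sqNorm F z ≠ 0) : IsStrictlyPositive r := by
  refine ⟨hr, fun z => ?_⟩
  have hval : (val r z).re * sqNorm G z = sqNorm F z := by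
    rw [← Complex.re_mul_ofReal, ← val_sqPoly, ← val_mul, h, val_sqPoly, Complex.ofReal_re]
  refine pos_of_mul_pos_left ?_ (sqNorm_nonneg G z)
  exact hval ▸ (sqNorm_nonneg F z).lt_of_ne' (hF z)

theorem totalDegree_eq_of_mul_sqPoly (h : r * sqPoly G = sqPoly F) (hF : sqPoly F ≠ 0) :
    r.totalDegree = 2 * r.degreeOf 0 := by
  obtain ⟨hr0, hG⟩ := mul_ne_zero_iff.1 (h ▸ hF)
  have hdegF := totalDegree_sqPoly hF
  have hdegG := totalDegree_sqPoly hG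
  rw [← h, MvPolynomial.totalDegree_mul_of_isDomain hr0 hG,
    MvPolynomial.degreeOf_mul_eq hr0 hG] at hdegF
  omega

theorem isHermitianSymm_of_mul_sqPoly (h : r * sqPoly G = sqPoly F) (hG : sqPoly G ≠ 0) :
    IsHermitianSymm r :=
  (isHermitianSymm_sqPoly G).of_mul_left hG <| by
    rw [mul_comm, h]
    exact isHermitianSymm_sqPoly F

theorem exists_eq_prod_absSqSub_mul (h : r * sqPoly G = sqPoly F) (hF : sqPoly F ≠ 0) :
    ∃ (K : ℕ) (p : Fin K → ℂ) (s : BiPoly), r = (∏ j, absSqSub (p j)) * s ∧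
      IsStrictlyPositive s ∧ s.totalDegree = 2 * s.degreeOf 0 := by
  have hr := isHermitianSymm_of_mul_sqPoly h (mul_ne_zero_iff.1 (h ▸ hF)).2
  induction hn : (sqPoly F).totalDegree using Nat.strong_induction_on generalizing r F G with
  | _ n ih =>
  subst hn
  by_cases hzero : ∃ p, sqNorm F p = 0
  · obtain ⟨p, hp⟩ := hzero
    obtain ⟨F', hF'⟩ := exists_sqPoly_eq_absSqSub_mul hp
    have hF'0 : sqPoly F' ≠ 0 := (mul_ne_zero_iff.1 (hF' ▸ hF)).2
    have hdeg : (sqPoly F').totalDegree < (sqPoly F).totalDegree :=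
      hF' ▸ totalDegree_lt_totalDegree_absSqSub_mul p hF'0
    by_cases hGp : sqNorm G p = 0
    · obtain ⟨G', hG'⟩ := exists_sqPoly_eq_absSqSub_mul hGp
      refine ih _ hdeg (G := G') (mul_left_cancel₀ (absSqSub_ne_zero p) ?_) hF'0 hr rfl
      rw [← hF', ← h, hG', mul_left_comm]
    · obtain ⟨r', rfl⟩ := absSqSub_dvd_of_mul_sqPoly hr (h.trans hF') hGp
      have h' : r' * sqPoly G = sqPoly F' :=
        mul_left_cancel₀ (absSqSub_ne_zero p) (by rw [← hF', ← h, mul_assoc])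
      obtain ⟨K, q, s, rfl, hs⟩ := ih _ hdeg h' hF'0
        (isHermitianSymm_of_mul_sqPoly h' (mul_ne_zero_iff.1 (h' ▸ hF'0)).2) rfl
      exact ⟨K + 1, Fin.cons p q, s, by simp [Fin.prod_univ_succ, mul_assoc], hs⟩
  · push Not at hzero
    exact ⟨0, Fin.elim0, r, by simp, isStrictlyPositive_of_mul_sqPoly hr h hzero,
      totalDegree_eq_of_mul_sqPoly h hF⟩

theorem setOf_val_prod_absSqSub_mul_eq_zero {K : ℕ} {p : Fin K → ℂ} {s : BiPoly}
    (hs : IsStrictlyPositive s) :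
    {z | val ((∏ j, absSqSub (p j)) * s) z = 0} = Set.range p := by
  ext z
  have hprod : val (∏ j, absSqSub (p j)) z = ∏ j, val (absSqSub (p j)) z := map_prod ..
  simp only [Set.mem_ofPred_eq, val_mul, mul_eq_zero, hs.val_ne_zero z, or_false, hprod,
    Finset.prod_eq_zero_iff, Finset.mem_univ, true_and, val_absSqSub_eq_zero, Set.mem_range,
    eq_comm (a := z)]

theorem prod_absSqSub_mul_mem_PInfty {K : ℕ} (p : Fin K → ℂ) {t : BiPoly} (ht : t ∈ PInfty) :
    (∏ j, absSqSub (p j)) * t ∈ PInfty := by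
  induction K with
  | zero => simpa using ht
  | succ K ih =>
    obtain ⟨N, F, hF⟩ := mem_PInfty_iff.1 (ih fun j => p j.succ)
    rw [Fin.prod_univ_succ, mul_assoc, hF, ← sqPoly_X_sub_C_mul]
    exact mem_PInfty_iff.2 ⟨N, _, rfl⟩

end Factorization

section Quotients

open MvPolynomial (X)

theorem val_one_add_X_mul_X_pow (N : ℕ) (z : ℂ) :
    val ((1 + X 0 * X 1) ^ N) z = (1 + z * conj z) ^ N := by
  simp [val, pol]

theorem isHermitianSymm_one_add_X_mul_X : IsHermitianSymm (1 + X 0 * X 1) := by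
  rw [isHermitianSymm_iff]
  simp [hermConj_apply, mul_comm]

theorem one_add_X_mul_X_pow_mem_PInfty (N : ℕ) : ((1 + X 0 * X 1) ^ N : BiPoly) ∈ PInfty := by
  refine ⟨isHermitianSymm_one_add_X_mul_X.pow N, N + 1,
    fun k => Polynomial.monomial k (√(N.choose k) : ℂ), fun z => ?_⟩
  rw [val_one_add_X_mul_X_pow, add_comm, add_pow, Finset.sum_range, sqNorm, Complex.ofReal_sum]
  refine Finset.sum_congr rfl fun k _ => ?_
  rw [Complex.mul_conj', Polynomial.eval_monomial, norm_mul, norm_pow, mul_pow, Complex.norm_real,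
    Real.norm_of_nonneg (Real.sqrt_nonneg _), Real.sq_sqrt (Nat.cast_nonneg _)]
  push_cast
  ring

theorem one_add_X_mul_X_pow_ne_zero (N : ℕ) : ((1 + X 0 * X 1) ^ N : BiPoly) ≠ 0 := by
  intro h
  have hval := val_one_add_X_mul_X_pow N 0
  simp [h, val, pol] at hval

theorem IsStrictlyPositive.exists_one_add_X_mul_X_pow_mul_mem_PInfty {s : BiPoly}
    (hs : IsStrictlyPositive s) (hdeg : s.totalDegree = 2 * s.degreeOf 0) :
    ∃ N : ℕ, (1 + X 0 * X 1) ^ N * s ∈ PInfty := by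
  have hs0 : s ≠ 0 := by
    rintro rfl
    exact hs.val_ne_zero 0 (map_zero _)
  obtain ⟨m, hm, hmd⟩ := hs.1.exists_mem_support_of_totalDegree_eq hs0 hdeg
  obtain ⟨N, n, F, hF⟩ := hs.exists_sqNorm hs.1.le_degreeOf_zero hm hmd
  refine ⟨N, (isHermitianSymm_one_add_X_mul_X.pow N).mul hs.1, n, F, fun z => ?_⟩
  rw [val_mul, val_one_add_X_mul_X_pow, hF]

theorem IsHermitianSymm.mem_Q_iff {r : BiPoly} (hr : IsHermitianSymm r) :
    r ∈ Q ↔ ∃ p ∈ PInfty, ∃ q ∈ PInfty, q ≠ 0 ∧ r * q = p := by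
  refine ⟨fun ⟨_, p, hp, q, hq, hq0, h⟩ => ⟨p, hp, q, hq, hq0, ?_⟩,
    fun ⟨p, hp, q, hq, hq0, h⟩ => ⟨hr, p, hp, q, hq, hq0, fun z hz => ?_⟩⟩
  · refine mul_right_cancel₀ hq0 (eq_of_val_eq fun z => ?_)
    by_cases hz : val q z = 0
    · rw [val_mul, hz, mul_zero, val_mul, hz, mul_zero]
    · rw [val_mul, val_mul, val_mul, h z hz, div_mul_cancel₀ _ hz]
  · rw [eq_div_iff hz, ← val_mul, h]

theorem zero_mem_PInfty : (0 : BiPoly) ∈ PInfty :=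
  mem_PInfty_iff.2 ⟨0, 0, sqPoly_zero.symm⟩

end Quotients

end HermPoly

theorem corollary4p2 (r : HermPoly.BiPoly) (hr : HermPoly.IsHermitianSymm r) :
    r ∈ HermPoly.Q ↔
      r = 0 ∨
      ∃ (K : ℕ) (p : Fin K → ℂ) (s : HermPoly.BiPoly),
        {z : ℂ | HermPoly.val r z = 0} = Set.range p ∧
        r = (∏ j, HermPoly.absSqSub (p j)) * s ∧
        HermPoly.IsStrictlyPositive s ∧
        MvPolynomial.totalDegree s = 2 * MvPolynomial.degreeOf 0 s := by
  open HermPoly in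
  rw [hr.mem_Q_iff]
  constructor
  · rintro ⟨p, hp, q, hq, hq0, hrq⟩
    obtain ⟨N, F, rfl⟩ := mem_PInfty_iff.1 hp
    obtain ⟨M, G, rfl⟩ := mem_PInfty_iff.1 hq
    refine or_iff_not_imp_left.2 fun hr0 => ?_
    obtain ⟨K, p, s, rfl, hs, hdeg⟩ :=
      exists_eq_prod_absSqSub_mul hrq (hrq ▸ mul_ne_zero hr0 hq0)
    exact ⟨K, p, s, setOf_val_prod_absSqSub_mul_eq_zero hs, rfl, hs, hdeg⟩
  · rintro (rfl | ⟨K, p, s, -, rfl, hs, hdeg⟩)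
    · exact ⟨0, zero_mem_PInfty, _, one_add_X_mul_X_pow_mem_PInfty 0,
        one_add_X_mul_X_pow_ne_zero 0, zero_mul _⟩
    · obtain ⟨N, hN⟩ := hs.exists_one_add_X_mul_X_pow_mul_mem_PInfty hdeg
      refine ⟨_, prod_absSqSub_mul_mem_PInfty p hN, _, one_add_X_mul_X_pow_mem_PInfty N,
        one_add_X_mul_X_pow_ne_zero N, ?_⟩
      rw [mul_assoc, mul_comm s]
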